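/- For $d_1,d_2,d_3\in\mathbb N$ let $\sigma_P(d_1,d_2,d_3)$ be the convex cone of all real polynomials $f(x,y,z)$ of degree at most $d_1$ in $x$, at most $d_2$ in $y$ and at most $d_3$ in $z$ such that $f(x,y,z)\ge 0$ for all $(x,y,z)\in\mathbb R^3$, and let $Q_P(d_1,d_2,d_3)$ be the subset of those $f\in\sigma_P(d_1,d_2,d_3)$ that can be written on $\mathbb R^3$ as a finite sum $f=\sum_{j=1}^r|F_j|^2$, where the $F_j$ are polynomials in $x,y,z$ (with complex coefficients allowed). An element $f_0\neq0$ of a convex cone $U$ is called extremal in $U$ if every segment with end points in $U$ that contains $f_0$ in its relative interior lies on the ray $\{cf_0: c\ge0\}$; equivalently, if $f_0=g+h$ with $g,h\in U$ implies that $g$ and $h$ are non-negative multiples of $f_0$. Then each of the four polynomials $$P_1=(xyz-z+y+x)^2,\quad P_2=(yz-xz+xy+1)^2,\quad P_3=(yz-xz-xy-1)^2,\quad P_4=(xz+yz+xy-1)^2$$ is extremal both in $Q_P(2,2,2)$ and in $\sigma_P(2,2,2)$. -/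

import Mathlib

/-- The class of real polynomials in three variables, of degree at most `d₁`, `d₂`, `d₃` in the
first, second and third variable respectively, which are non-negative on `ℝ³`. -/
def sigmaP (d₁ d₂ d₃ : ℕ) : Set (MvPolynomial (Fin 3) ℝ) :=
  {f | f.degreeOf 0 ≤ d₁ ∧ f.degreeOf 1 ≤ d₂ ∧ f.degreeOf 2 ≤ d₃ ∧
    ∀ x : Fin 3 → ℝ, 0 ≤ MvPolynomial.eval x f}

/-- The polynomials of the class `sigmaP d₁ d₂ d₃` that admit on `ℝ³` a representation
`f = ∑ |F_j|²` as a finite sum of squared moduli of polynomials. Complex coefficients are allowed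
for the `F_j`; this gives the same class as real ones, as `|A + i B|² = A² + B²`. -/
def QP (d₁ d₂ d₃ : ℕ) : Set (MvPolynomial (Fin 3) ℝ) :=
  {f | f ∈ sigmaP d₁ d₂ d₃ ∧
    ∃ (r : ℕ) (F : Fin r → MvPolynomial (Fin 3) ℂ), ∀ x : Fin 3 → ℝ,
      MvPolynomial.eval x f =
        ∑ j, ‖MvPolynomial.eval (fun i => (x i : ℂ)) (F j)‖ ^ 2}

/-- `f₀` is an extremal element of the convex cone `U`: it is a nonzero element of `U`, and the
only segments in `U` that contain `f₀` in their relative interior are those which lie on the ray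
`{c • f₀ | c ≥ 0}`. (For a cone these segments have to be excepted, as every nonzero `f₀` is the
midpoint of `0` and `2 • f₀`.) -/
def IsExtremal {E : Type*} [AddCommGroup E] [Module ℝ E] (U : Set E) (f₀ : E) : Prop :=
  f₀ ∈ U ∧ f₀ ≠ 0 ∧
    ∀ g ∈ U, ∀ h ∈ U, f₀ ∈ openSegment ℝ g h →
      (∃ c : ℝ, 0 ≤ c ∧ g = c • f₀) ∧ (∃ c : ℝ, 0 ≤ c ∧ h = c • f₀)

/-- The four polynomials `P₁, P₂, P₃, P₄` (indexed from `0`) in `x = X 0`, `y = X 1`, `z = X 2`. -/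
noncomputable def examplePoly : Fin 4 → MvPolynomial (Fin 3) ℝ :=
  let x : MvPolynomial (Fin 3) ℝ := MvPolynomial.X 0
  let y : MvPolynomial (Fin 3) ℝ := MvPolynomial.X 1
  let z : MvPolynomial (Fin 3) ℝ := MvPolynomial.X 2
  ![(x * y * z - z + y + x) ^ 2,
    (y * z - x * z + x * y + 1) ^ 2,
    (y * z - x * z - x * y - 1) ^ 2,
    (x * z + y * z + x * y - 1) ^ 2]

/-! Each example is the square of a polynomial `p` that is affine in each variable and depends on
all three. A summand `g` of `p ^ 2` in either cone satisfies `0 ≤ g ≤ p ^ 2`, and this alone forces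
`g = c • p ^ 2`, so both cones are treated at once. On an axis-parallel line where `p` is not
constant, `g` is at most quadratic and has a double zero at the zero of `p`, hence is proportional
to `p ^ 2` there (`Polynomial.eval_mul_sq_eq_of_le_sq`). Freezing the variables one at a time makes
the factor a global constant (`mul_substOn_sq`). -/

/-- A real polynomial that is squeezed between `0` and the square of a non-constant affine function
has degree at most `2`. -/
theorem Polynomial.degree_le_two_of_le_sq {q : Polynomial ℝ} {α β : ℝ} (hβ : β ≠ 0)
    (h0 : ∀ t, 0 ≤ q.eval t) (h1 : ∀ t, q.eval t ≤ (α + β * t) ^ 2) : q.degree ≤ 2 := by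
  by_contra hd
  set l : Polynomial ℝ := Polynomial.C β * Polynomial.X + Polynomial.C α with hl
  have hl1 : l.degree = 1 := Polynomial.degree_linear hβ
  have hQ : (l ^ 2).degree = 2 := by rw [Polynomial.degree_pow, hl1]; rfl
  have hQ0 : l ^ 2 ≠ 0 := by
    intro h
    rw [h] at hQ
    simp at hQ
  have ht := Polynomial.abs_div_tendsto_atTop_atTop_of_degree_gt q (l ^ 2)
    (by rw [hQ]; exact not_le.mp hd) hQ0
  obtain ⟨t, ht⟩ := (ht.eventually_gt_atTop 1).exists
  have hle := h1 t
  have hev : (l ^ 2).eval t = (α + β * t) ^ 2 := by simp [hl]; ring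
  rw [hev, abs_of_nonneg (div_nonneg (h0 t) (sq_nonneg _))] at ht
  exact absurd (div_le_one_of_le₀ hle (sq_nonneg _)) (not_le.mpr ht)

/-- A real polynomial that is squeezed between `0` and the square of a non-constant affine function
is proportional to this square. -/
theorem Polynomial.eval_mul_sq_eq_of_le_sq {q : Polynomial ℝ} {α β : ℝ} (hβ : β ≠ 0)
    (h0 : ∀ t, 0 ≤ q.eval t) (h1 : ∀ t, q.eval t ≤ (α + β * t) ^ 2) (s t : ℝ) :
    q.eval t * (α + β * s) ^ 2 = q.eval s * (α + β * t) ^ 2 := by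
  obtain ⟨a, b, c, hq⟩ : ∃ a b c : ℝ, ∀ t, q.eval t = a * t ^ 2 + b * t + c :=
    ⟨q.coeff 2, q.coeff 1, q.coeff 0, fun t => by
      conv_lhs => rw [Polynomial.eq_quadratic_of_degree_le_two
        (Polynomial.degree_le_two_of_le_sq hβ h0 h1)]
      simp⟩
  obtain ⟨r, rfl⟩ : ∃ r, α = -(β * r) := ⟨-α / β, by field_simp⟩
  have hr : a * r ^ 2 + b * r + c = 0 := by
    have h := h0 r
    have h' := h1 r
    rw [hq] at h h'
    refine le_antisymm (h'.trans_eq (by ring)) h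
  -- Since `q` vanishes at `r`, `q (r + u) = a * u ^ 2 + (2 * a * r + b) * u`; nonnegativity in `u`
  -- makes `r` a double root.
  have hdisc : discrim a (2 * a * r + b) 0 ≤ 0 := discrim_le_zero fun u => by
    have h := h0 (r + u)
    rw [hq] at h
    linear_combination h + hr
  have hb : b = -(2 * a * r) := by
    have h : (2 * a * r + b) ^ 2 = 0 :=
      le_antisymm (by simpa [discrim] using hdisc) (sq_nonneg _)
    linear_combination pow_eq_zero_iff two_ne_zero |>.mp h
  have hc : c = a * r ^ 2 := by linear_combination hr - r * hb
  rw [hq, hq, hb, hc]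
  ring

/-! ### Multiaffine polynomials and substitution -/

namespace MvPolynomial

variable {σ : Type*} [DecidableEq σ]

/-- A polynomial function is multiaffine if it is affine in each variable separately. -/
def IsMultiaffine (p : MvPolynomial σ ℝ) : Prop :=
  ∀ (i : σ) (v : σ → ℝ) (t : ℝ),
    eval (Function.update v i t) p = eval v p + (t - v i) * eval v (pderiv i p)

/-- Substitution of the values `w i`, for `i ∈ S`, for the variables with index in `S`. -/
noncomputable def substOn (w : σ → ℝ) (S : Finset σ) :
    MvPolynomial σ ℝ →ₐ[ℝ] MvPolynomial σ ℝ :=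
  aeval fun i => if i ∈ S then C (w i) else X i

theorem eval_substOn (w v : σ → ℝ) (S : Finset σ) (f : MvPolynomial σ ℝ) :
    eval v (substOn w S f) = eval (fun i => if i ∈ S then w i else v i) f := by
  rw [substOn, aeval_def, eval₂_eq, map_sum, eval_eq]
  refine Finset.sum_congr rfl fun d _ => ?_
  rw [map_mul, map_prod]
  congr 1
  · simp
  · exact Finset.prod_congr rfl fun i _ => by rw [map_pow]; split_ifs <;> simp

theorem eval_substOn_singleton (w v : σ → ℝ) (i : σ) (f : MvPolynomial σ ℝ) :
    eval v (substOn w {i} f) = eval (Function.update v i (w i)) f := by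
  rw [eval_substOn]
  congr 2
  ext j
  by_cases h : j = i
  · subst h; simp
  · simp [h]

theorem substOn_empty (w : σ → ℝ) (f : MvPolynomial σ ℝ) : substOn w ∅ f = f :=
  funext fun v => by simp [eval_substOn]

theorem substOn_insert (w : σ → ℝ) (i : σ) (S : Finset σ) (f : MvPolynomial σ ℝ) :
    substOn w (insert i S) f = substOn w S (substOn w {i} f) :=
  funext fun v => by
    rw [eval_substOn, eval_substOn, eval_substOn_singleton]
    congr 2
    ext j
    by_cases h : j = i
    · subst h; simp
    · simp [h]

theorem substOn_univ [Fintype σ] (w : σ → ℝ) (f : MvPolynomial σ ℝ) :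
    substOn w Finset.univ f = C (eval w f) :=
  funext fun v => by simp [eval_substOn]

theorem substOn_ne_zero {w : σ → ℝ} {p : MvPolynomial σ ℝ} (hw : eval w p ≠ 0) (S : Finset σ) :
    substOn w S p ≠ 0 := by
  intro h
  have h' := eval_substOn w w S p
  rw [h] at h'
  simp at h'
  exact hw h'.symm

/-- The restriction of a polynomial to the line through `v` in direction `i`. -/
noncomputable def restrictLine (v : σ → ℝ) (i : σ) (f : MvPolynomial σ ℝ) : Polynomial ℝ :=
  aeval (fun j => if j = i then Polynomial.X else Polynomial.C (v j)) f

theorem eval_restrictLine (v : σ → ℝ) (i : σ) (f : MvPolynomial σ ℝ) (t : ℝ) :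
    (restrictLine v i f).eval t = eval (Function.update v i t) f := by
  rw [restrictLine, aeval_def, eval₂_eq, Polynomial.eval_finsetSum, eval_eq]
  refine Finset.sum_congr rfl fun d _ => ?_
  rw [Polynomial.eval_mul, Polynomial.eval_prod]
  congr 1
  · simp
  · refine Finset.prod_congr rfl fun j _ => ?_
    rw [Polynomial.eval_pow]
    by_cases h : j = i
    · subst h; simp
    · simp [h]

theorem mul_substOn_singleton_sq {p g : MvPolynomial σ ℝ} (hp : p.IsMultiaffine) {i : σ}
    (hi : pderiv i p ≠ 0) (h0 : ∀ v, 0 ≤ eval v g) (h1 : ∀ v, eval v g ≤ eval v p ^ 2)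
    (w : σ → ℝ) :
    g * substOn w {i} p ^ 2 = substOn w {i} g * p ^ 2 := by
  rw [← sub_eq_zero]
  -- The factor `pderiv i p` absorbs the lines on which `p` is constant, where the one-variable
  -- lemma says nothing.
  refine (mul_eq_zero.mp ?_).resolve_right hi
  refine funext fun v => ?_
  simp only [map_mul, map_sub, map_pow, map_zero, eval_substOn_singleton]
  by_cases hβ : eval v (pderiv i p) = 0
  · rw [hβ, mul_zero]
  have hline : ∀ t, eval (Function.update v i t) p =
      (eval v p - v i * eval v (pderiv i p)) + eval v (pderiv i p) * t := fun t => by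
    rw [hp]; ring
  have key := Polynomial.eval_mul_sq_eq_of_le_sq (q := restrictLine v i g) hβ
    (fun t => by rw [eval_restrictLine]; exact h0 _)
    (fun t => by rw [eval_restrictLine, ← hline]; exact h1 _) (w i) (v i)
  rw [← hline, ← hline, eval_restrictLine, eval_restrictLine, Function.update_eq_self] at key
  rw [key, sub_self, zero_mul]

/-- Freezing the variables of `S` in the one-variable identity links `S` to `insert i S`. The common
factor `substOn w S p ^ 2` cancels because `p` does not vanish at `w`. -/
theorem mul_substOn_sq {p g : MvPolynomial σ ℝ} (hp : p.IsMultiaffine)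
    (hd : ∀ i, pderiv i p ≠ 0) (h0 : ∀ v, 0 ≤ eval v g) (h1 : ∀ v, eval v g ≤ eval v p ^ 2)
    {w : σ → ℝ} (hw : eval w p ≠ 0) (S : Finset σ) :
    g * substOn w S p ^ 2 = substOn w S g * p ^ 2 := by
  induction S using Finset.induction_on with
  | empty => simp only [substOn_empty]
  | insert i S _ ih =>
    have h := congrArg (substOn w S) (mul_substOn_singleton_sq hp (hd i) h0 h1 w)
    simp only [map_mul, map_pow, ← substOn_insert] at h
    refine mul_right_cancel₀ (pow_ne_zero 2 (substOn_ne_zero hw S)) ?_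
    linear_combination substOn w (insert i S) p ^ 2 * ih + p ^ 2 * h

/-- If `p` is multiaffine and depends on every variable, then each polynomial squeezed between `0`
and `p ^ 2` is a multiple of `p ^ 2`. -/
theorem IsMultiaffine.exists_eq_smul_sq [Fintype σ] {p g : MvPolynomial σ ℝ}
    (hp : p.IsMultiaffine) (hp0 : p ≠ 0) (hd : ∀ i, pderiv i p ≠ 0) (h0 : ∀ v, 0 ≤ eval v g)
    (h1 : ∀ v, eval v g ≤ eval v p ^ 2) : ∃ c : ℝ, 0 ≤ c ∧ g = c • p ^ 2 := by
  obtain ⟨w, hw⟩ : ∃ w, eval w p ≠ 0 := by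
    by_contra! h
    exact hp0 (funext fun v => by simpa using h v)
  have h := mul_substOn_sq hp hd h0 h1 hw Finset.univ
  rw [substOn_univ, substOn_univ, ← C_pow] at h
  refine ⟨eval w g / eval w p ^ 2, div_nonneg (h0 w) (sq_nonneg _), funext fun v => ?_⟩
  have hv := congrArg (eval v) h
  simp only [map_mul, map_pow, eval_C] at hv
  rw [smul_eval, map_pow]
  field_simp
  linear_combination hv

end MvPolynomial

/-! ### Extremality of squares -/

open MvPolynomial

theorem IsExtremal.of_forall_le {σ : Type*} {U : Set (MvPolynomial σ ℝ)} {f : MvPolynomial σ ℝ}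
    (hU : ∀ g ∈ U, ∀ v, 0 ≤ eval v g) (hf : f ∈ U) (hf0 : f ≠ 0)
    (h : ∀ g : MvPolynomial σ ℝ, (∀ v, 0 ≤ eval v g) → (∀ v, eval v g ≤ eval v f) →
      ∃ c : ℝ, 0 ≤ c ∧ g = c • f) : IsExtremal U f := by
  -- Positivity of the weights suffices: `a • g` lies between `0` and `f`.
  have key : ∀ g ∈ U, ∀ k ∈ U, ∀ a b : ℝ, 0 < a → 0 < b → a • g + b • k = f →
      ∃ c : ℝ, 0 ≤ c ∧ g = c • f := by
    intro g hg k hk a b ha hb hab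
    obtain ⟨c, hc, hgc⟩ := h (a • g)
      (fun v => by rw [smul_eval]; exact mul_nonneg ha.le (hU g hg v))
      (fun v => by
        rw [← hab, map_add, smul_eval _ k]
        exact le_add_of_nonneg_right (mul_nonneg hb.le (hU k hk v)))
    refine ⟨a⁻¹ * c, mul_nonneg (inv_nonneg.mpr ha.le) hc, ?_⟩
    rw [mul_smul, ← hgc, inv_smul_smul₀ ha.ne']
  refine ⟨hf, hf0, fun g hg k hk => ?_⟩
  rintro ⟨a, b, ha, hb, -, hab⟩
  exact ⟨key g hg k hk a b ha hb hab, key k hk g hg b a hb ha (by rw [add_comm]; exact hab)⟩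

theorem sq_mem_sigmaP {p : MvPolynomial (Fin 3) ℝ} (h : ∀ i, p.degreeOf i ≤ 1) :
    p ^ 2 ∈ sigmaP 2 2 2 := by
  have hd : ∀ i, (p ^ 2).degreeOf i ≤ 2 := fun i =>
    (degreeOf_pow_le i p 2).trans (by have := h i; omega)
  exact ⟨hd 0, hd 1, hd 2, fun v => by rw [map_pow]; exact sq_nonneg _⟩

theorem sq_mem_QP {p : MvPolynomial (Fin 3) ℝ} (h : ∀ i, p.degreeOf i ≤ 1) :
    p ^ 2 ∈ QP 2 2 2 := by
  refine ⟨sq_mem_sigmaP h, 1, fun _ => map Complex.ofRealHom p, fun v => ?_⟩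
  have hv : eval (fun i => (v i : ℂ)) (map Complex.ofRealHom p) = (eval v p : ℂ) :=
    (map_eval Complex.ofRealHom v p).symm ▸ rfl
  simp [hv]

/-- The square of a multiaffine polynomial which depends on all three variables is extremal. -/
theorem isExtremal_sq {p : MvPolynomial (Fin 3) ℝ} (hdeg : ∀ i, p.degreeOf i ≤ 1)
    (hp : p.IsMultiaffine) (hp0 : p ≠ 0) (hd : ∀ i, pderiv i p ≠ 0) :
    IsExtremal (QP 2 2 2) (p ^ 2) ∧ IsExtremal (sigmaP 2 2 2) (p ^ 2) := by
  have h : ∀ g : MvPolynomial (Fin 3) ℝ, (∀ v, 0 ≤ eval v g) →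
      (∀ v, eval v g ≤ eval v (p ^ 2)) → ∃ c : ℝ, 0 ≤ c ∧ g = c • p ^ 2 := fun g h0 h1 =>
    hp.exists_eq_smul_sq hp0 hd h0 fun v => by simpa using h1 v
  exact ⟨.of_forall_le (fun g hg => hg.1.2.2.2) (sq_mem_QP hdeg) (pow_ne_zero 2 hp0) h,
    .of_forall_le (fun g hg => hg.2.2.2) (sq_mem_sigmaP hdeg) (pow_ne_zero 2 hp0) h⟩

/-! ### The four examples as trilinear polynomials -/

/-- The polynomial whose coefficients of `xyz, xy, xz, yz, x, y, z, 1` are `a 0, …, a 7`. -/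
noncomputable def trilinear (a : Fin 8 → ℝ) : MvPolynomial (Fin 3) ℝ :=
  C (a 0) * (X 0 * X 1 * X 2) + C (a 1) * (X 0 * X 1) + C (a 2) * (X 0 * X 2) +
    C (a 3) * (X 1 * X 2) + C (a 4) * X 0 + C (a 5) * X 1 + C (a 6) * X 2 + C (a 7)

theorem degreeOf_trilinear_le (a : Fin 8 → ℝ) (i : Fin 3) : (trilinear a).degreeOf i ≤ 1 := by
  have h3 : degreeOf i (X 0 * X 1 * X 2 : MvPolynomial (Fin 3) ℝ) ≤ 1 :=
    (degreeOf_mul_le _ _ _).trans ((Nat.add_le_add_right (degreeOf_mul_le _ _ _) _).trans (by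
      fin_cases i <;> simp [degreeOf_X]))
  have h2 : ∀ j k : Fin 3, j ≠ k → degreeOf i (X j * X k : MvPolynomial (Fin 3) ℝ) ≤ 1 :=
    fun j k hjk => (degreeOf_mul_le _ _ _).trans (by
      rw [degreeOf_X, degreeOf_X]
      split_ifs with hj hk <;> simp_all)
  have h1 : ∀ j : Fin 3, degreeOf i (X j : MvPolynomial (Fin 3) ℝ) ≤ 1 := fun j => by
    rw [degreeOf_X]; split_ifs <;> simp
  have hC : ∀ (f : MvPolynomial (Fin 3) ℝ) (c : ℝ), degreeOf i f ≤ 1 → degreeOf i (C c * f) ≤ 1 :=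
    fun f c hf => (degreeOf_C_mul_le f i c).trans hf
  have hadd : ∀ f g : MvPolynomial (Fin 3) ℝ, degreeOf i f ≤ 1 → degreeOf i g ≤ 1 →
      degreeOf i (f + g) ≤ 1 := fun f g hf hg => (degreeOf_add_le i f g).trans (max_le hf hg)
  exact hadd _ _ (hadd _ _ (hadd _ _ (hadd _ _ (hadd _ _ (hadd _ _ (hadd _ _ (hC _ _ h3)
    (hC _ _ (h2 _ _ (by decide)))) (hC _ _ (h2 _ _ (by decide))))
    (hC _ _ (h2 _ _ (by decide)))) (hC _ _ (h1 _))) (hC _ _ (h1 _))) (hC _ _ (h1 _)))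
    (by rw [degreeOf_C]; exact zero_le_one)

theorem eval_trilinear (a : Fin 8 → ℝ) (v : Fin 3 → ℝ) : eval v (trilinear a) =
    a 0 * (v 0 * v 1 * v 2) + a 1 * (v 0 * v 1) + a 2 * (v 0 * v 2) + a 3 * (v 1 * v 2) +
      a 4 * v 0 + a 5 * v 1 + a 6 * v 2 + a 7 := by
  simp [trilinear]

theorem eval_pderiv_trilinear (a : Fin 8 → ℝ) (v : Fin 3 → ℝ) :
    eval v (pderiv 0 (trilinear a)) = a 0 * (v 1 * v 2) + a 1 * v 1 + a 2 * v 2 + a 4 ∧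
    eval v (pderiv 1 (trilinear a)) = a 0 * (v 0 * v 2) + a 1 * v 0 + a 3 * v 2 + a 5 ∧
    eval v (pderiv 2 (trilinear a)) = a 0 * (v 0 * v 1) + a 2 * v 0 + a 3 * v 1 + a 6 := by
  refine ⟨?_, ?_, ?_⟩ <;> simp [trilinear, pderiv_X] <;>
    exact Or.inl (by ring)

theorem isMultiaffine_trilinear (a : Fin 8 → ℝ) : (trilinear a).IsMultiaffine := by
  intro i v t
  obtain ⟨h0, h1, h2⟩ := eval_pderiv_trilinear a v
  fin_cases i <;> simp [eval_trilinear, h0, h1, h2] <;> ring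

/-- The square of a trilinear polynomial is extremal if there is a point at which neither the
polynomial nor any of its partial derivatives vanishes. -/
theorem isExtremal_trilinear_sq (a : Fin 8 → ℝ) (w : Fin 3 → ℝ) (h : eval w (trilinear a) ≠ 0)
    (hd : ∀ i, eval w (pderiv i (trilinear a)) ≠ 0) :
    IsExtremal (QP 2 2 2) (trilinear a ^ 2) ∧ IsExtremal (sigmaP 2 2 2) (trilinear a ^ 2) :=
  isExtremal_sq (degreeOf_trilinear_le a) (isMultiaffine_trilinear a)
    (fun h0 => h (by rw [h0, map_zero])) fun i h0 => hd i (by rw [h0, map_zero])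

theorem examplePoly_eq_trilinear_sq (k : Fin 4) :
    examplePoly k = trilinear (![![1, 0, 0, 0, 1, 1, -1, 0], ![0, 1, -1, 1, 0, 0, 0, 1],
      ![0, -1, -1, 1, 0, 0, 0, -1], ![0, 1, 1, 1, 0, 0, 0, -1]] k) ^ 2 := by
  refine MvPolynomial.funext fun v => ?_
  fin_cases k <;> simp [examplePoly, eval_trilinear] <;> ring

theorem proposition6 :
    ∀ k : Fin 4,
      IsExtremal (QP 2 2 2) (examplePoly k) ∧ IsExtremal (sigmaP 2 2 2) (examplePoly k) := by
  intro k
  rw [examplePoly_eq_trilinear_sq]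
  -- One point serves all four; its coordinates are distinct because differences of any two
  -- variables occur, up to sign, among the partial derivatives.
  refine isExtremal_trilinear_sq _ ![1, 2, 4] ?_ fun i => ?_
  · fin_cases k <;> simp [eval_trilinear] <;> norm_num
  · obtain ⟨h0, h1, h2⟩ := eval_pderiv_trilinear
      (![![1, 0, 0, 0, 1, 1, -1, 0], ![0, 1, -1, 1, 0, 0, 0, 1],
        ![0, -1, -1, 1, 0, 0, 0, -1], ![0, 1, 1, 1, 0, 0, 0, -1]] k) ![1, 2, 4]
    fin_cases i
    · refine h0.trans_ne ?_
      fin_cases k <;> simp <;> norm_num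
    · refine h1.trans_ne ?_
      fin_cases k <;> simp <;> norm_num
    · refine h2.trans_ne ?_
      fin_cases k <;> simp <;> norm_num
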